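/- Let $K$ be a number field, and let $R$ be an order in $K$, that is, a subring of $K$ (with $1$) which is finitely generated as a $\mathbb Z$-module and spans $K$ over $\mathbb Q$. Then $R$ is contained in the ring of integers $\overline R=\mathcal O_K$, which is the integral closure of $R$ in $K$. Assume that $R$ is an associated order, i.e. $\overline R=R\cdot U(\overline R)$: every $t\in\overline R$ can be written as $t=ru$ with $r\in R$ and $u$ a unit of $\overline R$. Assume also that the conductor ideal $I=(R:\overline R)=\{x\in\overline R : x\overline R\subseteq R\}$ is a radical ideal of $\overline R$. For an integral domain $D$ and a nonzero nonunit $a\in D$, let $\ell_D(a)$ be the set of all $n$ such that $a$ is a product of $n$ irreducible elements of $D$. Put $\rho_D(a)=\sup\{m/n : m,n\in\ell_D(a)\}$, and let $\rho(D)\in[0,\infty]$ be the supremum of $\rho_D(a)$ over all nonzero nonunits $a\in D$. Then $\rho_R(\alpha)=\rho_{\overline R}(\alpha)$ for every nonzero nonunit $\alpha\in R$. Moreover, $\rho(R)=\rho(\overline R)$. -/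

import Mathlib

open NumberField

/-- `R` is an order in the number field `K`: a subring of `K` (containing `1`) that is finitely
generated as a `ℤ`-module and spans `K` over `ℚ`. -/
structure IsNumberFieldOrder {K : Type*} [Field K] [NumberField K] (R : Subring K) : Prop where
  finite : Module.Finite ℤ R
  span_eq_top : Submodule.span ℚ (R : Set K) = ⊤

theorem IsNumberFieldOrder.isIntegral {K : Type*} [Field K] [NumberField K] {R : Subring K}
    (hR : IsNumberFieldOrder R) (x : R) : IsIntegral ℤ (x : K) := by
  have := hR.finite
  exact (Algebra.IsIntegral.isIntegral (R := ℤ) x).map R.subtype.toIntAlgHom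

/-- The inclusion of an order `R` of `K` into the ring of integers of `K`, which is the integral
closure of `R` in `K`. -/
def IsNumberFieldOrder.inclusion {K : Type*} [Field K] [NumberField K] {R : Subring K}
    (hR : IsNumberFieldOrder R) : R →+* 𝓞 K where
  toFun x := ⟨(x : K), hR.isIntegral x⟩
  map_one' := rfl
  map_mul' _ _ := rfl
  map_zero' := rfl
  map_add' _ _ := rfl

/-- An order `R` of `K`, regarded as a subring of the ring of integers of `K`. -/
def IsNumberFieldOrder.toSubring {K : Type*} [Field K] [NumberField K] {R : Subring K}
    (hR : IsNumberFieldOrder R) : Subring (𝓞 K) :=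
  hR.inclusion.range

/-- `R` is an associated subring of `T`: `T = R · U(T)`. -/
def IsAssociatedSubring {T : Type*} [CommRing T] (R : Subring T) : Prop :=
  ∀ t : T, ∃ r ∈ R, ∃ u : Tˣ, t = r * u

/-- The conductor ideal `(R : T) = {x ∈ T | x T ⊆ R}`, as an ideal of `T`. -/
def Subring.conductorIdeal {T : Type*} [CommRing T] (R : Subring T) : Ideal T where
  carrier := {x | ∀ t : T, x * t ∈ R}
  zero_mem' t := by simp [R.zero_mem]
  add_mem' {x y} hx hy t := by
    simpa only [add_mul] using R.add_mem (hx t) (hy t)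
  smul_mem' c x hx t := by
    have h := hx (c * t)
    rwa [← mul_assoc, mul_comm x c] at h

/-- The set of lengths of `a` in `D`: all `n` such that `a` is a product of `n` irreducible elements
of `D`. -/
def lengthSet {D : Type*} [CommRing D] (a : D) : Set ℕ :=
  {n | ∃ s : Multiset D, Multiset.card s = n ∧ (∀ p ∈ s, Irreducible p) ∧ s.prod = a}

/-- The elasticity `ρ_D(a) = sup {m / n : m, n lengths of a in D} ∈ [0, ∞]` of an element `a`
(meant for `a` a nonzero nonunit, so that `0` is not a length). -/
noncomputable def elementElasticity {D : Type*} [CommRing D] (a : D) : ENNReal :=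
  ⨆ m ∈ lengthSet a, ⨆ n ∈ lengthSet a, (m : ENNReal) / (n : ENNReal)

/-- The elasticity `ρ(D)`: the supremum in `[0, ∞]` of `ρ_D(a)` over all nonzero nonunits `a`. -/
noncomputable def ringElasticity (D : Type*) [CommRing D] : ENNReal :=
  ⨆ a : {a : D // a ≠ 0 ∧ ¬ IsUnit a}, elementElasticity (a : D)

/-! The conductor `I` is nonzero and radical, so `𝓞 K ⧸ I` is finite and reduced, a product of
finite fields, where every `a` satisfies `a ^ (m + 2) = a`. Since `I ⊆ R`, membership in `R` can be
tested modulo `I`. There, associatedness allows a factorization `β * γ` in `𝓞 K` of an element of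
`R` to be corrected by a unit `w` so that both factors lie in `R`
(`exists_unit_mul_mem_of_pow_eq_self`). As units of `𝓞 K` in `R` are units of `R`, irreducibles and
length sets then agree. -/

/-! ### Unit correction in a ring with `a ^ (m + 2) = a` -/

section QuasiInverse

variable {A : Type*} [CommRing A]

/-- If every element of `A` satisfies `a ^ (m + 2) = a` and `A = B · G` for a subring `B` and a group
`G` of units, then a factorization in `A` of an element of `B` can be moved into `B` by a unit in
`G`. -/
theorem exists_unit_mul_mem_of_pow_eq_self {m : ℕ} (hm : ∀ a : A, a ^ (m + 2) = a)
    (B : Subring A) (G : Subgroup Aˣ) (hBG : ∀ a : A, ∃ b ∈ B, ∃ u ∈ G, a = b * (u : A))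
    {β γ : A} (h : β * γ ∈ B) :
    ∃ w ∈ G, β * ((w : Aˣ) : A) ∈ B ∧ γ * ((w⁻¹ : Aˣ) : A) ∈ B := by
  -- `a ^ (m + 1)` is the idempotent supporting `a`; it lies in `B` because the associates `a` and
  -- `b` share it.
  have idem (a : A) : ∃ e ∈ B, a * e = a ∧ e = a * a ^ m := by
    obtain ⟨b, hb, u, -, rfl⟩ := hBG a
    refine ⟨b * b ^ m, B.mul_mem hb (B.pow_mem hb m), ?_, ?_⟩
    · linear_combination (u : A) * hm b
    · have h1 : b * b ^ m * (b * u) = b * u := by linear_combination (u : A) * hm b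
      have h2 : (b * u) * (b * u) ^ m * b = b := by
        have := hm (b * u)
        apply u.isUnit.mul_right_cancel
        linear_combination this
      calc b * b ^ m = (b * u) * (b * u) ^ m * b * b ^ m := by rw [h2]
        _ = (b * b ^ m * (b * u)) * (b * u) ^ m := by ring
        _ = _ := by rw [h1]
  obtain ⟨e, he, hβe, hee⟩ := idem β
  obtain ⟨f, hf, hγf, hff⟩ := idem γ
  have e2 : e * e = e := by
    calc e * e = (β * e) * β ^ m := by rw [hee]; ring
      _ = e := by rw [hβe, ← hee]
  have f2 : f * f = f := by
    calc f * f = (γ * f) * γ ^ m := by rw [hff]; ring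
      _ = f := by rw [hγf, ← hff]
  -- `z` is a unit: `β` on the support `e`, the inverse of `γ` on the part of `f` outside `e`, and
  -- `1` elsewhere.
  set z : A := β + (1 - e) * (γ ^ m * f + 1 - f) with hz
  have hez : e * z = β := by
    rw [hz]
    linear_combination hβe - (γ ^ m * f + 1 - f) * e2
  have hγz : γ * z = β * γ + (1 - e) * f := by
    rw [hz]
    linear_combination (1 - e) * (-f * hff - hγf + f2)
  have hz1 : z * (β ^ m * e + (1 - e) * (γ + 1 - f)) = 1 := by
    have h1 : (1 - e) * (z * (1 - f)) = (1 - e) * (1 - f) := by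
      rw [hz]
      linear_combination -(1 - f) * hβe + (γ ^ m * f + 1 - f) * (1 - f) * e2 +
        (1 - e) * (1 - γ ^ m) * f2
    linear_combination β ^ m * hez - hee + (1 - e) * hγz + h1 - γ * hβe + f * e2
  obtain ⟨b, hb, u, hu, hzb⟩ := hBG z
  set y : A := β ^ m * e + (1 - e) * (γ + 1 - f)
  -- As `z` is a unit, so is `b`, and its inverse `b ^ m` stays in `B`.
  have hbu : b * b ^ m = 1 := by
    have h1 : b * (u * y) = 1 := by linear_combination hz1 - y * hzb
    calc b * b ^ m = b * b ^ m * (b * (u * y)) := by rw [h1, mul_one]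
      _ = b ^ (m + 2) * (u * y) := by ring
      _ = 1 := by rw [hm, h1]
  refine ⟨u⁻¹, G.inv_mem hu, ?_, ?_⟩
  · have : β * ((u⁻¹ : Aˣ) : A) = e * b := by
      rw [Units.mul_inv_eq_iff_eq_mul, ← hez, hzb, mul_assoc]
    rw [this]
    exact B.mul_mem he hb
  · have : γ * ((u⁻¹⁻¹ : Aˣ) : A) = (β * γ + (1 - e) * f) * b ^ m := by
      rw [inv_inv, ← hγz, hzb]
      linear_combination (-γ * u) * hbu
    rw [this]
    exact B.mul_mem (B.add_mem h (B.mul_mem (B.sub_mem B.one_mem he) hf)) (B.pow_mem hb m)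

end QuasiInverse

/-! ### Transfer of lengths -/

section Lengths

variable {D T : Type*} [CommRing D] [CommRing T]

/-- A nonunit has at least one irreducible factor, which absorbs the unit. -/
theorem lengthSet_subset_of_associated {a b : D} (h : Associated a b) (ha : ¬ IsUnit a) :
    lengthSet a ⊆ lengthSet b := by
  rintro n ⟨s, hn, hs, hsa⟩
  obtain ⟨u, rfl⟩ := h
  induction s using Multiset.induction_on with
  | empty => exact absurd (by simp [← hsa]) ha
  | cons p s _ =>
    refine ⟨(p * u) ::ₘ s, by simpa using hn, fun q hq ↦ ?_, ?_⟩
    · rcases Multiset.mem_cons.1 hq with rfl | hq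
      · exact (irreducible_mul_units u).2 (hs p (Multiset.mem_cons_self _ _))
      · exact hs q (Multiset.mem_cons_of_mem hq)
    · rw [Multiset.prod_cons] at hsa ⊢
      rw [← hsa]
      ring

theorem lengthSet_eq_of_associated {a b : D} (h : Associated a b) (ha : ¬ IsUnit a) :
    lengthSet a = lengthSet b :=
  (lengthSet_subset_of_associated h ha).antisymm
    (lengthSet_subset_of_associated h.symm fun hb ↦ ha (h.isUnit_iff.2 hb))

/-- A ring homomorphism `φ : D → T` lifts factorizations up to units if each factorization in `T` of
an element `φ a` becomes the image of a factorization in `D` after multiplying the factors by a unit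
and its inverse. -/
def LiftsFactorizations (φ : D →+* T) : Prop :=
  ∀ (a : D) (β γ : T), φ a = β * γ →
    ∃ (w : Tˣ) (b c : D), φ b = β * (w : T) ∧ φ c = γ * ((w⁻¹ : Tˣ) : T)

theorem LiftsFactorizations.exists_mul {φ : D →+* T} (h : LiftsFactorizations φ)
    (hφ : Function.Injective φ) {a : D} {β γ : T} (ha : φ a = β * γ) :
    ∃ (w : Tˣ) (b c : D), a = b * c ∧ φ b = β * (w : T) ∧ φ c = γ * ((w⁻¹ : Tˣ) : T) := by
  obtain ⟨w, b, c, hb, hc⟩ := h a β γ ha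
  refine ⟨w, b, c, hφ ?_, hb, hc⟩
  rw [map_mul, hb, hc, ha]
  linear_combination (-β * γ) * w.mul_inv

theorem LiftsFactorizations.irreducible_map {φ : D →+* T} (h : LiftsFactorizations φ)
    (hφ : Function.Injective φ) [IsLocalHom φ] {a : D} (ha : Irreducible a) :
    Irreducible (φ a) := by
  refine ⟨fun hu ↦ ha.not_isUnit (isUnit_of_map_unit φ a hu), fun β γ hβγ ↦ ?_⟩
  obtain ⟨w, b, c, hbc, hb, hc⟩ := h.exists_mul hφ hβγ
  refine (ha.isUnit_or_isUnit hbc).imp (fun hu ↦ ?_) fun hu ↦ ?_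
  · have := hu.map φ
    rw [hb] at this
    exact isUnit_of_mul_isUnit_left this
  · have := hu.map φ
    rw [hc] at this
    exact isUnit_of_mul_isUnit_left this

/-- The unit `v` carries the corrections left over as factors are peeled off. The empty product is
excluded since there `a` could be a unit other than `1`. -/
theorem LiftsFactorizations.exists_irreducible_prod {φ : D →+* T} (h : LiftsFactorizations φ)
    (hφ : Function.Injective φ) [IsLocalHom φ] (s : Multiset T) :
    ∀ (a : D) (v : Tˣ), s ≠ 0 → (∀ p ∈ s, Irreducible p) → φ a = s.prod * (v : T) →
      Multiset.card s ∈ lengthSet a := by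
  induction s using Multiset.induction_on with
  | empty => exact fun _ _ h0 ↦ absurd rfl h0
  | cons p s ih =>
    intro a v _ hs ha
    have hp : Irreducible p := hs p (Multiset.mem_cons_self _ _)
    rw [Multiset.prod_cons, mul_assoc] at ha
    rcases eq_or_ne s 0 with rfl | hs0
    · refine ⟨{a}, by simp, fun q hq ↦ ?_, by simp⟩
      rw [Multiset.mem_singleton.1 hq]
      refine Irreducible.of_map (f := φ) ?_
      rw [ha, Multiset.prod_zero, one_mul]
      exact (irreducible_mul_units v).2 hp
    · obtain ⟨w, b, c, rfl, hb, hc⟩ := h.exists_mul hφ ha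
      obtain ⟨s', hcard, hirr, rfl⟩ := ih c (v * w⁻¹) hs0
        (fun q hq ↦ hs q (Multiset.mem_cons_of_mem hq)) (by rw [hc, Units.val_mul, mul_assoc])
      refine ⟨b ::ₘ s', by simp [hcard], fun q hq ↦ ?_, by simp⟩
      rcases Multiset.mem_cons.1 hq with rfl | hq
      · refine Irreducible.of_map (f := φ) ?_
        rw [hb]
        exact (irreducible_mul_units w).2 hp
      · exact hirr q hq

theorem LiftsFactorizations.lengthSet_map {φ : D →+* T} (h : LiftsFactorizations φ)
    (hφ : Function.Injective φ) [IsLocalHom φ] (a : D) :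
    lengthSet (φ a) = lengthSet a := by
  ext n
  constructor
  · rintro ⟨s, rfl, hs, hsa⟩
    rcases eq_or_ne s 0 with rfl | hs0
    · refine ⟨0, rfl, by simp, hφ ?_⟩
      rw [← hsa]
      simp
    · exact h.exists_irreducible_prod hφ s a 1 hs0 hs (by simp [hsa])
  · rintro ⟨s, rfl, hs, rfl⟩
    refine ⟨s.map φ, by simp, fun q hq ↦ ?_, (map_multiset_prod φ s).symm⟩
    obtain ⟨p, hp, rfl⟩ := Multiset.mem_map.1 hq
    exact h.irreducible_map hφ (hs p hp)

theorem LiftsFactorizations.elementElasticity_map {φ : D →+* T} (h : LiftsFactorizations φ)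
    (hφ : Function.Injective φ) [IsLocalHom φ] (a : D) :
    elementElasticity (φ a) = elementElasticity a := by
  simp only [elementElasticity, h.lengthSet_map hφ]

theorem LiftsFactorizations.ringElasticity_eq {φ : D →+* T} (h : LiftsFactorizations φ)
    (hφ : Function.Injective φ) [IsLocalHom φ] (hassoc : ∀ t : T, ∃ r : D, Associated (φ r) t) :
    ringElasticity D = ringElasticity T := by
  apply le_antisymm
  · refine iSup_le fun ⟨a, ha0, hau⟩ ↦ ?_
    rw [← h.elementElasticity_map hφ]
    exact le_iSup (fun x : {x : T // x ≠ 0 ∧ ¬ IsUnit x} ↦ elementElasticity (x : T))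
      ⟨φ a, (map_ne_zero_iff φ hφ).2 ha0, fun hu ↦ hau (isUnit_of_map_unit φ a hu)⟩
  · refine iSup_le fun ⟨t, ht0, htu⟩ ↦ ?_
    obtain ⟨r, hr⟩ := hassoc t
    have hru : ¬ IsUnit (φ r) := fun hu ↦ htu (hr.isUnit_iff.1 hu)
    have hr0 : r ≠ 0 := by
      rintro rfl
      rw [map_zero, Associated.comm, associated_zero_iff_eq_zero] at hr
      exact ht0 hr
    have : elementElasticity t = elementElasticity r := by
      simp only [elementElasticity, ← h.lengthSet_map hφ r, lengthSet_eq_of_associated hr hru]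
    rw [this]
    exact le_iSup (fun x : {x : D // x ≠ 0 ∧ ¬ IsUnit x} ↦ elementElasticity (x : D))
      ⟨r, hr0, fun hu ↦ hru (hu.map φ)⟩

end Lengths

/-- In a finite reduced commutative ring there is a uniform exponent `m + 2` with
`a ^ (m + 2) = a`. -/
theorem exists_pow_add_two_eq_self (A : Type*) [CommRing A] [Finite A] [IsReduced A] :
    ∃ m : ℕ, ∀ a : A, a ^ (m + 2) = a := by
  -- Pigeonhole: two power maps coincide, which makes `a ^ (k + 2) - a` nilpotent.
  have : ¬ Function.Injective fun (n : ℕ) (a : A) ↦ a ^ n := not_injective_infinite_finite _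
  simp only [Function.Injective, not_forall] at this
  obtain ⟨i, j, hij, hne⟩ := this
  wlog hlt : i < j generalizing i j
  · exact this j i hij.symm (Ne.symm hne) (by omega)
  obtain ⟨k, rfl⟩ := Nat.exists_eq_add_of_lt hlt
  refine ⟨k, fun a ↦ ?_⟩
  have h : a ^ i = a ^ (i + k + 1) := congrFun hij a
  have : (a ^ (k + 2) - a) ^ (i + 1) = 0 := by
    have e : a ^ (k + 2) - a = a * (a ^ (k + 1) - 1) := by ring
    rw [e, mul_pow]
    have : a ^ i * (a ^ (k + 1) - 1) = 0 := by linear_combination -h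
    linear_combination a * (a ^ (k + 1) - 1) ^ i * this
  exact sub_eq_zero.1 (pow_eq_zero_iff (Nat.succ_ne_zero i) |>.1 this)

/-! ### Reduction modulo the conductor -/

section Conductor

variable {T : Type*} [CommRing T] (S : Subring T)

theorem Subring.mk_conductorIdeal_mem_map_iff {t : T} :
    Ideal.Quotient.mk S.conductorIdeal t ∈ S.map (Ideal.Quotient.mk S.conductorIdeal) ↔ t ∈ S := by
  refine ⟨?_, fun h ↦ ⟨t, h, rfl⟩⟩
  rintro ⟨s, hs, hst⟩
  have h : s - t ∈ S.conductorIdeal := Ideal.Quotient.eq.1 hst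
  have h1 : s - t ∈ S := by simpa using h 1
  simpa using S.sub_mem hs h1

variable [Finite (T ⧸ S.conductorIdeal)]

/-- Modulo the conductor, the inverse of `x` is the power `x ^ m`. -/
theorem Subring.inv_mem_of_isRadical_conductorIdeal (hrad : S.conductorIdeal.IsRadical)
    {x y : T} (hxy : x * y = 1) (hx : x ∈ S) : y ∈ S := by
  have := (Ideal.isRadical_iff_quotient_reduced _).1 hrad
  obtain ⟨m, hm⟩ := exists_pow_add_two_eq_self (T ⧸ S.conductorIdeal)
  rw [← S.mk_conductorIdeal_mem_map_iff]
  refine ⟨x ^ m, S.pow_mem hx m, ?_⟩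
  have h1 := hm (Ideal.Quotient.mk _ x)
  have h2 := congrArg (Ideal.Quotient.mk S.conductorIdeal) hxy
  rw [map_mul, map_one] at h2
  rw [map_pow]
  generalize Ideal.Quotient.mk S.conductorIdeal x = X at *
  generalize Ideal.Quotient.mk S.conductorIdeal y = Y at *
  calc X ^ m = X ^ m * (X * Y) * (X * Y) := by rw [h2]; ring
    _ = X ^ (m + 2) * Y * Y := by ring
    _ = X * Y * Y := by rw [h1]
    _ = Y := by rw [h2, one_mul]

theorem Subring.exists_unit_mul_mem_of_isRadical_conductorIdeal
    (hrad : S.conductorIdeal.IsRadical) (hassoc : IsAssociatedSubring S)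
    {β γ : T} (h : β * γ ∈ S) :
    ∃ w : Tˣ, β * (w : T) ∈ S ∧ γ * ((w⁻¹ : Tˣ) : T) ∈ S := by
  have := (Ideal.isRadical_iff_quotient_reduced _).1 hrad
  obtain ⟨m, hm⟩ := exists_pow_add_two_eq_self (T ⧸ S.conductorIdeal)
  let π := Ideal.Quotient.mk S.conductorIdeal
  -- Taking only images of units of `T` as the group makes the correcting unit lift to `T`.
  obtain ⟨_, ⟨w, rfl⟩, h1, h2⟩ := exists_unit_mul_mem_of_pow_eq_self hm (S.map π)
    (Units.map (π : T →* T ⧸ S.conductorIdeal)).range (fun a ↦ by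
      obtain ⟨t, rfl⟩ := Ideal.Quotient.mk_surjective a
      obtain ⟨r, hr, u, rfl⟩ := hassoc t
      exact ⟨π r, ⟨r, hr, rfl⟩, _, ⟨u, rfl⟩, by simp [π]⟩)
    (β := π β) (γ := π γ) (by rw [← map_mul]; exact ⟨_, h, rfl⟩)
  refine ⟨w, ?_, ?_⟩
  · rw [← S.mk_conductorIdeal_mem_map_iff, map_mul]
    exact h1
  · rw [← S.mk_conductorIdeal_mem_map_iff, map_mul]
    rw [← map_inv] at h2
    exact h2

end Conductor

/-! ### Orders in number fields -/

section Order

variable {K : Type*} [Field K] [NumberField K] {R : Subring K} (hR : IsNumberFieldOrder R)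
include hR

theorem IsNumberFieldOrder.exists_nat_mul_mem (x : K) : ∃ n : ℕ, n ≠ 0 ∧ (n : K) * x ∈ R := by
  have hx : x ∈ Submodule.span ℚ (R : Set K) := hR.span_eq_top ▸ Submodule.mem_top
  induction hx using Submodule.span_induction with
  | mem x hx => exact ⟨1, one_ne_zero, by simpa using hx⟩
  | zero => exact ⟨1, one_ne_zero, by simp⟩
  | add x y _ _ hx hy =>
    obtain ⟨n, hn, hnx⟩ := hx
    obtain ⟨k, hk, hky⟩ := hy
    refine ⟨n * k, mul_ne_zero hn hk, ?_⟩
    have := R.add_mem (R.mul_mem (natCast_mem R k) hnx) (R.mul_mem (natCast_mem R n) hky)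
    convert this using 1
    push_cast
    ring
  | smul q x _ hx =>
    obtain ⟨n, hn, hnx⟩ := hx
    refine ⟨q.den * n, mul_ne_zero q.den_nz hn, ?_⟩
    have := R.mul_mem (intCast_mem R q.num) hnx
    convert this using 1
    have hq : (q.den : K) * (q : K) = q.num := by
      exact_mod_cast congrArg (Rat.cast (K := K)) (Rat.den_mul_eq_num q)
    rw [Rat.smul_def]
    push_cast
    linear_combination (n : K) * x * hq

theorem IsNumberFieldOrder.mem_toSubring_iff {t : 𝓞 K} : t ∈ hR.toSubring ↔ (t : K) ∈ R :=
  ⟨by rintro ⟨r, rfl⟩; exact r.2, fun h ↦ ⟨⟨t, h⟩, rfl⟩⟩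

/-- A common denominator for finitely many `ℤ`-generators of `𝓞 K` lies in the conductor. -/
theorem IsNumberFieldOrder.conductorIdeal_ne_bot : hR.toSubring.conductorIdeal ≠ ⊥ := by
  obtain ⟨G, hG⟩ := (Module.Finite.fg_top : (⊤ : Submodule ℤ (𝓞 K)).FG)
  choose n hn hnR using fun t : 𝓞 K ↦ hR.exists_nat_mul_mem (t : K)
  have key (t : 𝓞 K) : ((∏ g ∈ G, n g : ℕ) : 𝓞 K) * t ∈ hR.toSubring := by
    have ht : t ∈ Submodule.span ℤ (G : Set (𝓞 K)) := hG ▸ Submodule.mem_top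
    induction ht using Submodule.span_induction with
    | mem g hg =>
      obtain ⟨k, hk⟩ := Finset.dvd_prod_of_mem n (Finset.mem_coe.1 hg)
      have h1 : (n g : 𝓞 K) * g ∈ hR.toSubring := hR.mem_toSubring_iff.2 (by simpa using hnR g)
      have := hR.toSubring.mul_mem (natCast_mem hR.toSubring k) h1
      rw [hk]
      convert this using 1
      push_cast
      ring
    | zero => simp
    | add x y _ _ hx hy => simpa only [mul_add] using hR.toSubring.add_mem hx hy
    | smul c x _ hx => simpa only [mul_smul_comm] using hR.toSubring.zsmul_mem hx c
  intro hbot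
  have h0 : ((∏ g ∈ G, n g : ℕ) : 𝓞 K) ∈ hR.toSubring.conductorIdeal := key
  rw [hbot, Ideal.mem_bot, Nat.cast_eq_zero, Finset.prod_eq_zero_iff] at h0
  obtain ⟨g, -, hg⟩ := h0
  exact hn g hg

theorem IsNumberFieldOrder.inclusion_injective : Function.Injective hR.inclusion := by
  intro x y h
  exact Subtype.ext (congrArg (fun t : 𝓞 K ↦ (t : K)) h)

theorem IsNumberFieldOrder.finite_quotient_conductorIdeal :
    Finite (𝓞 K ⧸ hR.toSubring.conductorIdeal) :=
  Ideal.finiteQuotientOfFreeOfNeBot _ hR.conductorIdeal_ne_bot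

theorem IsNumberFieldOrder.isLocalHom_inclusion (hrad : hR.toSubring.conductorIdeal.IsRadical) :
    IsLocalHom hR.inclusion := by
  have := hR.finite_quotient_conductorIdeal
  refine ⟨fun a ha ↦ ?_⟩
  obtain ⟨y, hy⟩ := ha.exists_right_inv
  obtain ⟨b, rfl⟩ := hR.toSubring.inv_mem_of_isRadical_conductorIdeal hrad hy ⟨a, rfl⟩
  exact IsUnit.of_mul_eq_one b (hR.inclusion_injective (by rw [map_mul, hy, map_one]))

theorem IsNumberFieldOrder.liftsFactorizations_inclusion
    (hassoc : IsAssociatedSubring hR.toSubring)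
    (hrad : hR.toSubring.conductorIdeal.IsRadical) : LiftsFactorizations hR.inclusion := by
  have := hR.finite_quotient_conductorIdeal
  intro a β γ ha
  obtain ⟨w, ⟨b, hb⟩, ⟨c, hc⟩⟩ :=
    hR.toSubring.exists_unit_mul_mem_of_isRadical_conductorIdeal hrad hassoc
      (β := β) (γ := γ) ⟨a, ha⟩
  exact ⟨w, b, c, hb, hc⟩

end Order

theorem mainTheorem6 {K : Type*} [Field K] [NumberField K] (R : Subring K)
    (hR : IsNumberFieldOrder R)
    (hassoc : IsAssociatedSubring hR.toSubring)
    (hrad : hR.toSubring.conductorIdeal.IsRadical) :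
    (∀ α : R, α ≠ 0 → ¬ IsUnit α →
      elementElasticity α = elementElasticity (hR.inclusion α)) ∧
    ringElasticity R = ringElasticity (𝓞 K) := by
  have := hR.isLocalHom_inclusion hrad
  have hlift := hR.liftsFactorizations_inclusion hassoc hrad
  refine ⟨fun α _ _ ↦ (hlift.elementElasticity_map hR.inclusion_injective α).symm,
    hlift.ringElasticity_eq hR.inclusion_injective fun t ↦ ?_⟩
  obtain ⟨_, ⟨r, rfl⟩, u, rfl⟩ := hassoc t
  exact ⟨r, u, rfl⟩
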